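/- Let $n\ge 1$, let $(V,\eta)$ be a real vector space of dimension $n+2$ with a symmetric bilinear form of signature $(1,n+1)$ (one negative direction), and let $p,q\in V$ be isotropic vectors with $\eta(p,q)=1$. Put $E=\{p,q\}^{\perp}$, a Euclidean space of dimension $n$. Let $SO(V)_{\mathbb{R}p}$ be the group of all $\eta$-orthogonal automorphisms of $V$ of determinant $1$ that preserve the isotropic line $\mathbb{R}p$, and let $\partial L^{n+1}$ be the set of isotropic lines of $V$ (the boundary of the Lobachevskian space $L^{n+1}$). Let $e_0=\frac{\sqrt2}{2}(p-q)$, $e_{n+1}=\frac{\sqrt2}{2}(p+q)$. Each isotropic line meets the affine hyperplane $e_0+(E\oplus\mathbb{R}e_{n+1})$ in exactly one point, which identifies $\partial L^{n+1}$ with the unit sphere of that hyperplane centred at $e_0$, and $\mathbb{R}p$ with the point $\sqrt2\,p$. Stereographic projection from $\sqrt2\,p$ onto $e_0+E\cong E$ then identifies $\partial L^{n+1}\setminus\{\mathbb{R}p\}$ with $E$, and through this bijection $SO(V)_{\mathbb{R}p}$ acts on $E$ (by similarity transformations). Let $G$ be a proper subgroup of $SO(V)_{\mathbb{R}p}$ that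 is a connected, not necessarily closed, Lie subgroup, i.e. $G$ is generated by $\exp\mathfrak{g}$ for some Lie subalgebra $\mathfrak{g}$ of $\mathfrak{gl}(V)$. Then the following are equivalent: 1. $G$ acts weakly-irreducibly on $V$, i.e. the only $G$-invariant subspaces $U\subseteq V$ for which $\eta|_U$ is nondegenerate are $U=0$ and $U=V$; 2. $G$ acts transitively on $\partial L^{n+1}\setminus\{\mathbb{R}p\}$; 3. $G$ acts transitively on $E$. -/

import Mathlib

open Module

noncomputable section

namespace Minkowski

/-- `η` is a symmetric bilinear form of signature `(1, n + 1)` (one minus sign) on a space of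
dimension `n + 2`: some basis `e₀, …, e_{n+1}` has Gram matrix `diag(-1, 1, …, 1)`. -/
def IsMinkowski {V : Type*} [AddCommGroup V] [Module ℝ V]
    (η : LinearMap.BilinForm ℝ V) (n : ℕ) : Prop :=
  ∃ e : Basis (Fin (n + 2)) ℝ V, ∀ i j,
    η (e i) (e j) = if i = j then (if i = 0 then -1 else 1) else 0

/-- The special orthogonal group `SO(V)` of `(V, η)`. -/
def SO {V : Type*} [AddCommGroup V] [Module ℝ V]
    (η : LinearMap.BilinForm ℝ V) : Subgroup (V ≃ₗ[ℝ] V) where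
  carrier := {f | (∀ x y, η (f x) (f y) = η x y) ∧ LinearEquiv.det f = 1}
  one_mem' := ⟨fun _ _ => rfl, map_one _⟩
  mul_mem' := by
    rintro f g ⟨hf, hf'⟩ ⟨hg, hg'⟩
    exact ⟨fun x y => (hf (g x) (g y)).trans (hg x y), by rw [map_mul, hf', hg', one_mul]⟩
  inv_mem' := by
    rintro f ⟨hf, hf'⟩
    refine ⟨fun x y => ?_, by rw [map_inv, hf', inv_one]⟩
    have h := hf (f⁻¹ x) (f⁻¹ y)
    rw [← LinearEquiv.mul_apply, ← LinearEquiv.mul_apply, mul_inv_cancel] at h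
    exact h.symm

/-- The image of a line (or any subspace) under a linear automorphism. -/
abbrev image {V : Type*} [AddCommGroup V] [Module ℝ V]
    (f : V ≃ₗ[ℝ] V) (l : Submodule ℝ V) : Submodule ℝ V :=
  l.map (f : V →ₗ[ℝ] V)

/-- The subgroup of `SO(V)` of the elements that preserve the line `ℝ p`. -/
def SOLine {V : Type*} [AddCommGroup V] [Module ℝ V]
    (η : LinearMap.BilinForm ℝ V) (p : V) : Subgroup (V ≃ₗ[ℝ] V) where
  carrier := {f | f ∈ SO η ∧ image f (ℝ ∙ p) = ℝ ∙ p}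
  one_mem' := ⟨one_mem _, Submodule.map_id _⟩
  mul_mem' := by
    rintro f g ⟨hf, hf'⟩ ⟨hg, hg'⟩
    refine ⟨mul_mem hf hg, ?_⟩
    have h := Submodule.map_comp (g : V →ₗ[ℝ] V) (f : V →ₗ[ℝ] V) (ℝ ∙ p)
    simp only [image] at hf' hg'
    rw [hg', hf'] at h
    exact h
  inv_mem' := by
    rintro f ⟨hf, hf'⟩
    refine ⟨inv_mem hf, ?_⟩
    have h := Submodule.map_comp (f : V →ₗ[ℝ] V) ((f⁻¹ : V ≃ₗ[ℝ] V) : V →ₗ[ℝ] V) (ℝ ∙ p)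
    simp only [image] at hf'
    rw [hf'] at h
    refine h.symm.trans ?_
    have h2 : ((f⁻¹ : V ≃ₗ[ℝ] V) : V →ₗ[ℝ] V) ∘ₗ (f : V →ₗ[ℝ] V) = LinearMap.id := by
      ext x
      exact f.symm_apply_apply x
    rw [h2, Submodule.map_id]

/-- `G` is a connected (not necessarily closed) Lie subgroup of `GL(V)`: the subgroup generated by
`exp 𝔤` for some Lie subalgebra `𝔤` of `𝔤𝔩(V)` (a linear subspace closed under
commutators). The norm on the finite-dimensional space `V` serves only to sum
the exponential series; which norm it is does not matter. -/
def IsConnectedLieSubgroup {V : Type*} [NormedAddCommGroup V] [NormedSpace ℝ V]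
    (G : Subgroup (V ≃ₗ[ℝ] V)) : Prop :=
  ∃ 𝔤 : Submodule ℝ (V →L[ℝ] V), (∀ X ∈ 𝔤, ∀ Y ∈ 𝔤, X * Y - Y * X ∈ 𝔤) ∧
    G = Subgroup.closure {g | ∃ X ∈ 𝔤, ∀ v, g v = NormedSpace.exp X v}

/-- `G` preserves no nondegenerate proper subspace of `V` (proper: neither `0` nor `V`). -/
def IsWeaklyIrreducible {V : Type*} [AddCommGroup V] [Module ℝ V]
    (η : LinearMap.BilinForm ℝ V) (G : Subgroup (V ≃ₗ[ℝ] V)) : Prop :=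
  ∀ U : Submodule ℝ V, (∀ g ∈ G, ∀ u ∈ U, g u ∈ U) → (η.restrict U).Nondegenerate →
    U = ⊥ ∨ U = ⊤

/-- The boundary of Lobachevskian space: the set of isotropic lines of `V`. -/
def boundary {V : Type*} [AddCommGroup V] [Module ℝ V]
    (η : LinearMap.BilinForm ℝ V) : Set (Submodule ℝ V) :=
  {l | finrank ℝ l = 1 ∧ ∀ x ∈ l, η x x = 0}

/-- `G` acts transitively on the set of isotropic lines other than `ℝ p`. -/
def IsTransitiveOnBoundary {V : Type*} [AddCommGroup V] [Module ℝ V]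
    (η : LinearMap.BilinForm ℝ V) (p : V) (G : Subgroup (V ≃ₗ[ℝ] V)) : Prop :=
  ∀ l ∈ boundary η \ {ℝ ∙ p}, ∀ l' ∈ boundary η \ {ℝ ∙ p}, ∃ g ∈ G, image g l = l'

/-- The Euclidean space `E`: the orthogonal complement of the plane spanned by `p` and `q`. -/
def euclid {V : Type*} [AddCommGroup V] [Module ℝ V]
    (η : LinearMap.BilinForm ℝ V) (p q : V) : Submodule ℝ V :=
  LinearMap.ker (η p) ⊓ LinearMap.ker (η q)

/-- Inverse stereographic projection. With `e₀ = (√2/2)(p - q)` and `e_{n+1} = (√2/2)(p + q)`, the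
isotropic lines are the points of the unit sphere of the hyperplane `e₀ + E ⊕ ℝ e_{n+1}` centred at
`e₀`; the line `ℝ p` is the pole `p₀ = e₀ + e_{n+1} = √2 p`. The point `Y` of `E` is sent to the
point of the sphere, other than `p₀`, on the affine line through `p₀` and `e₀ + Y`. -/
def stereoInv {V : Type*} [AddCommGroup V] [Module ℝ V]
    (η : LinearMap.BilinForm ℝ V) (p q Y : V) : V :=
  √2 • p + (2 / (1 + η Y Y)) • ((√2 / 2) • (p - q) + Y - √2 • p)

/-- `G` acts transitively on `E`, where `g` acts on `E` by the similarity transformation that is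
conjugate, under stereographic projection, to its action on the isotropic lines: `g` sends `X` to
`Y` if and only if it sends the isotropic line of `X` to that of `Y`. -/
def IsTransitiveOnEuclid {V : Type*} [AddCommGroup V] [Module ℝ V]
    (η : LinearMap.BilinForm ℝ V) (p q : V) (G : Subgroup (V ≃ₗ[ℝ] V)) : Prop :=
  ∀ X ∈ euclid η p q, ∀ Y ∈ euclid η p q,
    ∃ g ∈ G, image g (ℝ ∙ stereoInv η p q X) = ℝ ∙ stereoInv η p q Y

end Minkowski

end

/-! Weak irreducibility enters through one consequence: an invariant subspace that contains `p` and
is not inside `p^⊥` is nondegenerate, hence equal to `V`. Let `𝔱` be the ideal of infinitesimal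
translations in the Lie algebra `𝔤`. The space `T = ℝ p + 𝔱 q` is then invariant. Modulo `𝔱`, `𝔤`
carries an invariant positive definite form, so there is a Casimir tensor `∑ eᵢ ⊗ eᵢ`
(`exists_casimir`); this replaces averaging over a compact group, since `G` need not be closed. If
some `X ∈ 𝔤` rescales `p`, it also rescales an opposite null vector `o`. Contracting the Casimir
tensor shows that `T + ℝ o`, with `T` now formed from `o`, is invariant (`apply_mem_of_dilation`),
so translations alone are transitive. If `𝔤` kills `p`, the Casimir operator shows that `𝔤` maps
`p^⊥` into `T` (`apply_mem_of_isometric`). Then `T + 𝔤 q + ℝ q` is invariant, hence all of `V`, and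
one exponential followed by a translation carries any normalized null vector to any other.
Conversely, a nondegenerate invariant splitting of `V` either has `p` in one summand, which
transitivity forces to be everything, or produces a second invariant null line, impossible in
dimension at least 3. The action on `E` is the boundary action in stereographic coordinates. -/

namespace Minkowski

/-! ### Parseval frames of semidefinite forms -/

section Frames

variable {L : Type*} [AddCommGroup L] [Module ℝ L]

/-- A positive semidefinite form on a finite-dimensional space has a finite Parseval frame modulo
its radical. -/
theorem exists_parseval_frame [FiniteDimensional ℝ L] (B : LinearMap.BilinForm ℝ L)
    (hs : ∀ x y, B x y = B y x) (hB : ∀ x, 0 ≤ B x x) :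
    ∃ (m : ℕ) (e : Fin m → L), ∀ y z, B (y - ∑ i, B y (e i) • e i) z = 0 := by
  obtain ⟨v, hv⟩ := LinearMap.BilinForm.exists_orthogonal_basis (B := B) ⟨fun x y => hs x y⟩
  have hvo : ∀ i j, i ≠ j → B (v i) (v j) = 0 := fun i j h => hv h
  have hcs : ∀ x z, B x x = 0 → B x z = 0 := by
    intro x z hx
    by_contra hne
    -- The coefficient is chosen so that this vector would have square `-1`.
    have h1 := hB (z - ((B z z + 1) / (2 * B x z)) • x)
    simp only [map_sub, map_smul, LinearMap.sub_apply, LinearMap.smul_apply, smul_eq_mul, hx,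
      hs z x] at h1
    have h2 : (B z z + 1) / (2 * B x z) * B x z = (B z z + 1) / 2 := by
      field_simp
    rw [h2] at h1
    linarith
  -- Null basis vectors become zero frame vectors, because `0⁻¹ = 0`.
  refine ⟨_, fun i => (√(B (v i) (v i)))⁻¹ • v i, fun y z => ?_⟩
  have key : B z = ∑ i, B ((√(B (v i) (v i)))⁻¹ • v i) z • B ((√(B (v i) (v i)))⁻¹ • v i) := by
    refine v.ext fun j => ?_
    rw [LinearMap.sum_apply, Finset.sum_eq_single j]
    · by_cases h0 : B (v j) (v j) = 0
      · simp [h0, hs z, hcs _ z h0]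
      · have hr : √(B (v j) (v j)) * √(B (v j) (v j)) = B (v j) (v j) :=
          Real.mul_self_sqrt (hB _)
        have hr0 : √(B (v j) (v j)) ≠ 0 := by
          intro h
          rw [h] at hr
          exact h0 (by linarith)
        simp only [map_smul, smul_eq_mul, LinearMap.smul_apply]
        generalize √(B (v j) (v j)) = r at hr hr0
        rw [← hr, hs z]
        field_simp
    · intro i _ hi
      simp [hvo i j hi]
    · simp
  rw [map_sub, LinearMap.sub_apply, sub_eq_zero, hs y z, key, LinearMap.sum_apply, map_sum,
    LinearMap.sum_apply]
  refine Finset.sum_congr rfl fun i _ => ?_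
  rw [LinearMap.smul_apply, map_smul B (B y _), LinearMap.smul_apply, smul_eq_mul,
    smul_eq_mul, mul_comm, hs y]

/-- The tensor `∑ eᵢ ⊗ eᵢ` of a Parseval frame is invariant under skew-symmetric maps. -/
theorem sum_frame_skew_eq_zero {B : LinearMap.BilinForm ℝ L} (hs : ∀ x y, B x y = B y x)
    {m : ℕ} {e : Fin m → L} (he : ∀ y z, B (y - ∑ i, B y (e i) • e i) z = 0)
    {D : L → L} (hD : ∀ x y, B (D x) y + B x (D y) = 0)
    (β : L →ₗ[ℝ] L →ₗ[ℝ] ℝ) (hβ : ∀ r, (∀ z, B r z = 0) → ∀ y, β r y = 0 ∧ β y r = 0) :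
    ∑ i, (β (D (e i)) (e i) + β (e i) (D (e i))) = 0 := by
  have h1 : ∀ x y, β x y = ∑ j, B x (e j) * β (e j) y := by
    intro x y
    have := (hβ _ (he x) y).1
    rw [map_sub, LinearMap.sub_apply, sub_eq_zero] at this
    simpa using this
  have h2 : ∀ x y, β y x = ∑ j, B x (e j) * β y (e j) := by
    intro x y
    have := (hβ _ (he x) y).2
    rw [map_sub, sub_eq_zero] at this
    simpa using this
  -- Expand each `D (e i)` in the frame; after swapping indices in one double sum, the coefficients
  -- cancel by skewness.
  rw [Finset.sum_add_distrib, Finset.sum_congr rfl fun i _ => h1 (D (e i)) (e i),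
    Finset.sum_congr rfl fun i _ => h2 (D (e i)) (e i), Finset.sum_comm (γ := Fin m),
    ← Finset.sum_add_distrib]
  refine Finset.sum_eq_zero fun i _ => ?_
  rw [← Finset.sum_add_distrib]
  refine Finset.sum_eq_zero fun j _ => ?_
  have := hD (e i) (e j)
  rw [hs (e i)] at this
  rw [← add_mul, add_comm, this, zero_mul]

end Frames

/-! ### Null vectors and parabolic Lie algebras -/

variable {V : Type*} [AddCommGroup V] [Module ℝ V]

theorem eq_zero_of_mem_span {η : LinearMap.BilinForm ℝ V} {p v : V} (hv : v ∈ ℝ ∙ p) {w : V}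
    (hw : η p w = 0) : η v w = 0 := by
  obtain ⟨c, rfl⟩ := Submodule.mem_span_singleton.1 hv
  simp [hw]

/-- `p` is a null vector of a nondegenerate symmetric form `η` that is positive semidefinite on
`p^⊥` with radical `ℝ p`, as happens in Lorentzian signature. -/
structure IsNullVector (η : LinearMap.BilinForm ℝ V) (p : V) : Prop where
  symm : ∀ x y, η x y = η y x
  eq_zero : ∀ x, (∀ y, η x y = 0) → x = 0
  null : η p p = 0
  nonneg : ∀ w, η p w = 0 → 0 ≤ η w w
  mem_span : ∀ w, η p w = 0 → η w w = 0 → w ∈ ℝ ∙ p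

namespace IsNullVector

variable {η : LinearMap.BilinForm ℝ V} {p : V}

theorem isRefl (hp : IsNullVector η p) : η.IsRefl := fun x y h => by rw [hp.symm, h]

theorem nondegenerate (hp : IsNullVector η p) : η.Nondegenerate :=
  ⟨fun x h => hp.eq_zero x h, fun x h => hp.eq_zero x fun y => by rw [hp.symm, h]⟩

theorem mem_of_forall_orthogonal (hp : IsNullVector η p)
    [FiniteDimensional ℝ V] (T : Submodule ℝ V) {v : V}
    (h : ∀ k, (∀ t ∈ T, η t k = 0) → η k v = 0) : v ∈ T := by
  rw [← LinearMap.BilinForm.orthogonal_orthogonal hp.nondegenerate hp.isRefl T]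
  exact fun k hk => h k hk

end IsNullVector

/-- `𝔤` is a Lie algebra of `η`-skew endomorphisms that preserve the line `ℝ p`. -/
structure IsParabolic (η : LinearMap.BilinForm ℝ V) (p : V) (𝔤 : Submodule ℝ (End ℝ V)) :
    Prop where
  lie_mem : ∀ X ∈ 𝔤, ∀ Y ∈ 𝔤, X * Y - Y * X ∈ 𝔤
  skew : ∀ X ∈ 𝔤, ∀ x y, η (X x) y + η x (X y) = 0
  line : ∀ X ∈ 𝔤, X p ∈ ℝ ∙ p

/-- The elements of `𝔤` that act on `p^⊥ / ℝ p` as infinitesimal translations. -/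
def translations (η : LinearMap.BilinForm ℝ V) (p : V) (𝔤 : Submodule ℝ (End ℝ V)) :
    Submodule ℝ (End ℝ V) where
  carrier := {X | X ∈ 𝔤 ∧ X p = 0 ∧ ∀ w, η p w = 0 → X w ∈ ℝ ∙ p}
  zero_mem' := ⟨zero_mem _, rfl, fun _ _ => zero_mem _⟩
  add_mem' := by
    rintro X Y ⟨h1, h2, h3⟩ ⟨k1, k2, k3⟩
    exact ⟨add_mem h1 k1, by simp [h2, k2], fun w hw => add_mem (h3 w hw) (k3 w hw)⟩
  smul_mem' := by
    rintro c X ⟨h1, h2, h3⟩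
    exact ⟨Submodule.smul_mem _ _ h1, by simp [h2], fun w hw => Submodule.smul_mem _ _ (h3 w hw)⟩

/-- The subspace `ℝ p + 𝔱 q` of `p^⊥`, where `𝔱` is the space of infinitesimal translations. -/
def translationSpace (η : LinearMap.BilinForm ℝ V) (p q : V) (𝔤 : Submodule ℝ (End ℝ V)) :
    Submodule ℝ V :=
  (ℝ ∙ p) ⊔ (translations η p 𝔤).map (LinearMap.applyₗ q)

namespace IsParabolic

variable {η : LinearMap.BilinForm ℝ V} {p q : V} {𝔤 : Submodule ℝ (End ℝ V)}

theorem p_mem : p ∈ translationSpace η p q 𝔤 :=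
  Submodule.mem_sup_left (Submodule.mem_span_singleton_self p)

theorem span_le : (ℝ ∙ p) ≤ translationSpace η p q 𝔤 := le_sup_left

theorem apply_q_mem {X : End ℝ V} (hX : X ∈ translations η p 𝔤) :
    X q ∈ translationSpace η p q 𝔤 :=
  Submodule.mem_sup_right ⟨X, hX, rfl⟩

theorem mem_iff {v : V} : v ∈ translationSpace η p q 𝔤 ↔
    ∃ c : ℝ, ∃ X ∈ translations η p 𝔤, v = c • p + X q := by
  constructor
  · intro h
    obtain ⟨a, ha, b, ⟨X, hX, rfl⟩, rfl⟩ := Submodule.mem_sup.1 h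
    obtain ⟨c, rfl⟩ := Submodule.mem_span_singleton.1 ha
    exact ⟨c, X, hX, rfl⟩
  · rintro ⟨c, X, hX, rfl⟩
    exact add_mem (Submodule.smul_mem _ _ p_mem) (apply_q_mem hX)

theorem translations_apply_mem (hpq : η p q = 1) {X : End ℝ V}
    (hX : X ∈ translations η p 𝔤) (v : V) : X v ∈ translationSpace η p q 𝔤 := by
  have : X v = η p v • X q + X (v - η p v • q) := by simp
  rw [this]
  exact add_mem (Submodule.smul_mem _ _ (apply_q_mem hX))
    (span_le (hX.2.2 _ (by simp [hpq])))

theorem apply_mem_span (h𝔤 : IsParabolic η p 𝔤)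
    {X : End ℝ V} (hX : X ∈ 𝔤) {v : V} (hv : v ∈ ℝ ∙ p) : X v ∈ ℝ ∙ p := by
  obtain ⟨c, rfl⟩ := Submodule.mem_span_singleton.1 hv
  rw [map_smul]
  exact Submodule.smul_mem _ _ (h𝔤.line X hX)

/-- The orthogonal complement of an invariant subspace is invariant. -/
theorem orthogonal_invariant (h𝔤 : IsParabolic η p 𝔤) {U : Submodule ℝ V} {X : End ℝ V} (hX : X ∈ 𝔤)
    (hU : ∀ u ∈ U, X u ∈ U) {k : V} (hk : ∀ t ∈ U, η t k = 0) : ∀ t ∈ U, η t (X k) = 0 := by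
  intro t ht
  have := h𝔤.skew X hX t k
  rw [hk _ (hU t ht)] at this
  linarith

theorem apply_orthogonal (h𝔤 : IsParabolic η p 𝔤)
    {X : End ℝ V} (hX : X ∈ 𝔤) {w : V} (hw : η p w = 0) :
    η p (X w) = 0 := by
  have := h𝔤.skew X hX p w
  rw [eq_zero_of_mem_span (h𝔤.line X hX) hw] at this
  linarith

/-- The ideal property: `Y` preserves both `ℝ p` and `p^⊥`, while `X` kills the first and maps the
second into it. -/
theorem lie_mem_translations (h𝔤 : IsParabolic η p 𝔤) {Y : End ℝ V} (hY : Y ∈ 𝔤) {X : End ℝ V}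
    (hX : X ∈ translations η p 𝔤) : Y * X - X * Y ∈ translations η p 𝔤 := by
  obtain ⟨h1, h2, h3⟩ := hX
  have hk : ∀ v ∈ ℝ ∙ p, X v = 0 := by
    intro v hv
    obtain ⟨c, rfl⟩ := Submodule.mem_span_singleton.1 hv
    simp [h2]
  refine ⟨h𝔤.lie_mem Y hY X h1, ?_, fun w hw => ?_⟩
  · simp [h2, hk _ (h𝔤.line Y hY)]
  · exact sub_mem (h𝔤.apply_mem_span hY (h3 w hw)) (h3 _ (h𝔤.apply_orthogonal hY hw))

/-- Write `Y X q = [Y, X] q + X (Y q)`: the bracket is again a translation, and translations map all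
of `V` into this space. -/
theorem apply_mem_translationSpace (h𝔤 : IsParabolic η p 𝔤)
    (hpq : η p q = 1) {Y : End ℝ V} (hY : Y ∈ 𝔤) {t : V}
    (ht : t ∈ translationSpace η p q 𝔤) : Y t ∈ translationSpace η p q 𝔤 := by
  obtain ⟨c, X, hX, rfl⟩ := mem_iff.1 ht
  have : Y (c • p + X q) = c • Y p + ((Y * X - X * Y) q + X (Y q)) := by simp
  rw [this]
  exact add_mem (Submodule.smul_mem _ _ (span_le (h𝔤.line Y hY)))
    (add_mem (apply_q_mem (h𝔤.lie_mem_translations hY hX))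
      (translations_apply_mem hpq hX _))

theorem orthogonal_translationSpace (h𝔤 : IsParabolic η p 𝔤) (hp : IsNullVector η p) {t : V}
    (ht : t ∈ translationSpace η p q 𝔤) : η p t = 0 := by
  obtain ⟨c, X, hX, rfl⟩ := mem_iff.1 ht
  have := h𝔤.skew X hX.1 p q
  rw [hX.2.1] at this
  simp only [map_zero, LinearMap.zero_apply, zero_add] at this
  simp [hp.null, this]

/-- The invariant Casimir tensor of `𝔤` modulo the infinitesimal translations. -/
theorem exists_casimir (h𝔤 : IsParabolic η p 𝔤) (hp : IsNullVector η p)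
    [FiniteDimensional ℝ V] (hpq : η p q = 1) :
    ∃ (m : ℕ) (e : Fin m → End ℝ V), (∀ i, e i ∈ 𝔤) ∧
      (∀ Y ∈ 𝔤, ∃ c : Fin m → ℝ, Y - ∑ i, c i • e i ∈ translations η p 𝔤) ∧
      ∀ X ∈ 𝔤, ∀ β : End ℝ V →ₗ[ℝ] End ℝ V →ₗ[ℝ] ℝ,
        (∀ Y ∈ translations η p 𝔤, ∀ Z ∈ 𝔤, β Y Z = 0 ∧ β Z Y = 0) →
        ∑ i, (β (X * e i - e i * X) (e i) + β (e i) (X * e i - e i * X)) = 0 := by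
  let W : Submodule ℝ V := LinearMap.ker (η p)
  have hW : ∀ w : W, η p w = 0 := fun w => w.2
  obtain ⟨m, f, hf⟩ := exists_parseval_frame (η.restrict W) (fun x y => hp.symm x y)
    (fun x => hp.nonneg x (hW x))
  have hrad : ∀ r : W, (∀ z, (η.restrict W) r z = 0) → (r : V) ∈ ℝ ∙ p :=
    fun r hr => hp.mem_span r (hW r) (hr r)
  have hpp : ∀ {v w : V}, v ∈ ℝ ∙ p → η p w = 0 → η v w = 0 ∧ η w v = 0 := fun hv hw =>
    ⟨eq_zero_of_mem_span hv hw, by rw [hp.symm]; exact eq_zero_of_mem_span hv hw⟩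
  have hinv : ∀ X ∈ 𝔤, ∀ Y ∈ 𝔤, ∀ Z ∈ 𝔤,
      ∑ j, (η (Y (X (f j))) (Z (f j)) + η (Y (f j)) (Z (X (f j)))) = 0 := by
    intro X hX Y hY Z hZ
    exact sum_frame_skew_eq_zero (B := η.restrict W) (fun x y => hp.symm x y) hf
      (D := fun w => ⟨X w, h𝔤.apply_orthogonal hX (hW w)⟩)
      (fun x y => h𝔤.skew X hX x y)
      (η.compl₁₂ (Y ∘ₗ W.subtype) (Z ∘ₗ W.subtype)) (fun r hr y =>
        ⟨(hpp (h𝔤.apply_mem_span hY (hrad r hr)) (h𝔤.apply_orthogonal hZ (hW y))).1,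
        (hpp (h𝔤.apply_mem_span hZ (hrad r hr)) (h𝔤.apply_orthogonal hY (hW y))).2⟩)
  -- The product of the characters by which `𝔤` scales `p`, plus the trace form of the action on
  -- `p^⊥ / ℝ p`. Both are invariant, and the radical is exactly the translation ideal.
  let B : LinearMap.BilinForm ℝ 𝔤 := LinearMap.mk₂ ℝ
    (fun Y Z => η ((Y : End ℝ V) p) q * η ((Z : End ℝ V) p) q +
      ∑ j, η ((Y : End ℝ V) (f j)) ((Z : End ℝ V) (f j)))
    (fun Y Y' Z => by simp [Finset.sum_add_distrib]; ring)
    (fun c Y Z => by simp [← Finset.mul_sum]; ring)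
    (fun Y Z Z' => by simp [Finset.sum_add_distrib]; ring)
    (fun c Y Z => by simp [← Finset.mul_sum]; ring)
  have hBdef : ∀ Y Z : 𝔤, B Y Z = η ((Y : End ℝ V) p) q * η ((Z : End ℝ V) p) q +
      ∑ j, η ((Y : End ℝ V) (f j)) ((Z : End ℝ V) (f j)) := fun _ _ => rfl
  have hBs : ∀ Y Z, B Y Z = B Z Y := by
    intro Y Z
    rw [hBdef, hBdef, mul_comm]
    exact congrArg _ (Finset.sum_congr rfl fun j _ => hp.symm _ _)
  have hfn : ∀ (Y : 𝔤) j, 0 ≤ η ((Y : End ℝ V) (f j)) ((Y : End ℝ V) (f j)) :=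
    fun Y j => hp.nonneg _ (h𝔤.apply_orthogonal Y.2 (hW _))
  have hBnn : ∀ Y, 0 ≤ B Y Y := fun Y =>
    add_nonneg (mul_self_nonneg _) (Finset.sum_nonneg fun j _ => hfn Y j)
  have hBrad : ∀ Y : 𝔤, B Y Y = 0 → (Y : End ℝ V) ∈ translations η p 𝔤 := by
    intro Y hY
    rw [hBdef, add_eq_zero_iff_of_nonneg (mul_self_nonneg _)
      (Finset.sum_nonneg fun j _ => hfn Y j), Finset.sum_eq_zero_iff_of_nonneg
        (fun j _ => hfn Y j), mul_self_eq_zero] at hY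
    have hYf : ∀ j, (Y : End ℝ V) (f j) ∈ ℝ ∙ p := fun j =>
      hp.mem_span _ (h𝔤.apply_orthogonal Y.2 (hW _)) (hY.2 j (Finset.mem_univ j))
    refine ⟨Y.2, ?_, fun w hw => ?_⟩
    · obtain ⟨c, hc⟩ := Submodule.mem_span_singleton.1 (h𝔤.line Y Y.2)
      have := hY.1
      rw [← hc] at this ⊢
      simp only [map_smul, LinearMap.smul_apply, hpq, smul_eq_mul, mul_one] at this
      simp [this]
    · have h1 := h𝔤.apply_mem_span Y.2 (hrad _ (hf ⟨w, hw⟩))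
      simp only [AddSubgroupClass.coe_sub, Submodule.coe_sum, Submodule.coe_smul, map_sub,
        map_sum, map_smul] at h1
      have h2 : ∑ j, (η.restrict W) ⟨w, hw⟩ (f j) • (Y : End ℝ V) (f j) ∈ ℝ ∙ p :=
        Submodule.sum_mem _ fun j _ => Submodule.smul_mem _ _ (hYf j)
      simpa using add_mem h1 h2
  have hBinv : ∀ X Y Z : 𝔤, B ⟨X * Y - Y * X, h𝔤.lie_mem X X.2 Y Y.2⟩ Z +
      B Y ⟨X * Z - Z * X, h𝔤.lie_mem X X.2 Z Z.2⟩ = 0 := by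
    intro X Y Z
    have hb : ∀ Y : 𝔤, (X : End ℝ V) ((Y : End ℝ V) p) = (Y : End ℝ V) ((X : End ℝ V) p) := by
      intro Y
      obtain ⟨a, ha⟩ := Submodule.mem_span_singleton.1 (h𝔤.line X X.2)
      obtain ⟨b, hb⟩ := Submodule.mem_span_singleton.1 (h𝔤.line Y Y.2)
      rw [← ha, ← hb, map_smul, map_smul, ← ha, ← hb, smul_comm]
    have h1 := hinv X X.2 Y Y.2 Z Z.2
    have h2 : ∀ j, η ((X : End ℝ V) ((Y : End ℝ V) (f j))) ((Z : End ℝ V) (f j)) +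
      η ((Y : End ℝ V) (f j)) ((X : End ℝ V) ((Z : End ℝ V) (f j))) = 0 :=
      fun j => h𝔤.skew X X.2 _ _
    have h3 := Finset.sum_eq_zero (s := Finset.univ) fun j _ => h2 j
    rw [hBdef, hBdef]
    simp only [LinearMap.sub_apply, Module.End.mul_apply, hb, sub_self, map_zero,
      LinearMap.zero_apply, zero_mul, mul_zero, zero_add, map_sub]
    rw [← Finset.sum_add_distrib]
    -- The remaining sum is skewness of `X` (`h3`) minus invariance of the frame tensor (`h1`).
    rw [← sub_self (0 : ℝ)]
    nth_rewrite 1 [← h3]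
    nth_rewrite 1 [← h1]
    rw [← Finset.sum_sub_distrib]
    exact Finset.sum_congr rfl fun j _ => by ring
  obtain ⟨k, e, he⟩ := exists_parseval_frame B hBs hBnn
  refine ⟨k, fun i => e i, fun i => (e i).2, fun Y hY => ?_, fun X hX β hβ => ?_⟩
  · refine ⟨fun i => B ⟨Y, hY⟩ (e i), ?_⟩
    have := hBrad _ (he ⟨Y, hY⟩ _)
    simpa using this
  · exact sum_frame_skew_eq_zero hBs he (hBinv ⟨X, hX⟩) (β.compl₁₂ 𝔤.subtype 𝔤.subtype)
      (fun r hr y => hβ r (hBrad r (hr r)) y y.2)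

/-- An element of `𝔤` that rescales `p` also rescales a null vector opposite to `p`. -/
theorem exists_opposite (h𝔤 : IsParabolic η p 𝔤) (hp : IsNullVector η p)
    [FiniteDimensional ℝ V] (hpq : η p q = 1) {X : End ℝ V} (hX : X ∈ 𝔤)
    {a : ℝ} (ha : a ≠ 0) (hXp : X p = a • p) : ∃ z, η p z = 1 ∧ X z = -a • z := by
  -- By skewness the range of `X + a` lies in `p^⊥`, so it misses `q`; in finite dimension a kernel
  -- vector exists.
  have hns : ¬ Function.Surjective (X + a • (1 : End ℝ V)) := by
    intro hsurj
    obtain ⟨v, hv⟩ := hsurj q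
    have h1 := h𝔤.skew X hX p v
    rw [hXp] at h1
    rw [← hv] at hpq
    simp only [map_smul, LinearMap.smul_apply, smul_eq_mul, LinearMap.add_apply, map_add,
      Module.End.one_apply] at h1 hpq
    linarith
  rw [← LinearMap.injective_iff_surjective, injective_iff_map_eq_zero] at hns
  push Not at hns
  obtain ⟨z, hz, hz0⟩ := hns
  have hXz : X z = -a • z := by
    simp only [LinearMap.add_apply, LinearMap.smul_apply, Module.End.one_apply] at hz
    rw [neg_smul]
    exact eq_neg_of_add_eq_zero_left hz
  have hzz : η z z = 0 := by
    have h1 := h𝔤.skew X hX z z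
    rw [hXz] at h1
    simp only [map_smul, LinearMap.smul_apply, smul_eq_mul] at h1
    have : a * η z z = 0 := by linarith
    exact (mul_eq_zero.1 this).resolve_left ha
  -- A null vector of `p^⊥` is a multiple of `p`, which has eigenvalue `a`, not `-a`.
  have hpz : η p z ≠ 0 := by
    intro h
    obtain ⟨c, rfl⟩ := Submodule.mem_span_singleton.1 (hp.mem_span z h hzz)
    rw [map_smul, hXp, smul_smul, smul_smul, ← sub_eq_zero, ← sub_smul] at hXz
    have hp0 : p ≠ 0 := by
      rintro rfl
      simp at hz0
    have hc := (smul_eq_zero.1 hXz).resolve_right hp0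
    have : a * c = 0 := by linarith
    exact hz0 (by rw [(mul_eq_zero.1 this).resolve_left ha, zero_smul])
  exact ⟨(η p z)⁻¹ • z, by simp [hpz], by rw [map_smul, hXz, smul_comm]⟩

/-- If an element of `𝔤` scales `p` and `q` by inverse nontrivial rates, then `𝔤 q` lies in
`ℝ p + 𝔱 q + ℝ q`. -/
theorem apply_mem_of_dilation (h𝔤 : IsParabolic η p 𝔤) (hp : IsNullVector η p)
    [FiniteDimensional ℝ V] (hpq : η p q = 1) {X : End ℝ V}
    (hX : X ∈ 𝔤) {a : ℝ} (ha : a ≠ 0) (hXq : X q = -a • q) {Y : End ℝ V} (hY : Y ∈ 𝔤) :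
    Y q ∈ translationSpace η p q 𝔤 ⊔ ℝ ∙ q := by
  obtain ⟨m, e, heg, hspan, hcas⟩ := h𝔤.exists_casimir hp hpq
  set U := translationSpace η p q 𝔤 ⊔ ℝ ∙ q with hU
  have hTU : translationSpace η p q 𝔤 ≤ U := le_sup_left
  have hqU : q ∈ U := Submodule.mem_sup_right (Submodule.mem_span_singleton_self q)
  have hXU : ∀ u ∈ U, X u ∈ U := by
    intro u hu
    obtain ⟨t, ht, s, hs, rfl⟩ := Submodule.mem_sup.1 hu
    obtain ⟨c, rfl⟩ := Submodule.mem_span_singleton.1 hs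
    rw [map_add, map_smul, hXq]
    exact add_mem (hTU (h𝔤.apply_mem_translationSpace hpq hX ht))
      (Submodule.smul_mem _ _ (Submodule.smul_mem _ _ hqU))
  -- Since `p` and `q` lie in `U`, the form is positive definite on this complement. The goal is
  -- that every `e i q` is orthogonal to it.
  let E : Submodule ℝ V := η.orthogonal U
  have hE : ∀ k : E, ∀ t ∈ U, η t k = 0 := fun k => k.2
  have hEW : ∀ k : E, η p k = 0 := fun k => hE k p (hTU p_mem)
  obtain ⟨l, f, hf⟩ := exists_parseval_frame (η.restrict E) (fun x y => hp.symm x y)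
    (fun x => hp.nonneg x (hEW x))
  have hrad : ∀ r : E, (∀ z, (η.restrict E) r z = 0) → r = 0 := by
    intro r hr
    obtain ⟨c, hc⟩ := Submodule.mem_span_singleton.1 (hp.mem_span r (hEW r) (hr r))
    have h1 := hE r q hqU
    rw [← hc, map_smul, hp.symm, hpq, smul_eq_mul, mul_one] at h1
    rw [h1, zero_smul] at hc
    exact Subtype.ext hc.symm
  have htr : ∀ k : E, ∀ Z ∈ translations η p 𝔤, η (Z q) k = 0 :=
    fun k Z hZ => hE k _ (hTU (apply_q_mem hZ))
  -- Invariance of the Casimir tensor, contracted twice with `Z ↦ η (Z q) k`, which vanishes on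
  -- translations.
  have h1 : ∀ k : E, a * ∑ i, η (e i q) k * η (e i q) k =
      ∑ i, η (e i q) (X k) * η (e i q) k := by
    intro k
    let ℓ : End ℝ V →ₗ[ℝ] ℝ := LinearMap.flip η (k : V) ∘ₗ LinearMap.applyₗ q
    have hℓ : ∀ Z, ℓ Z = η (Z q) k := fun _ => rfl
    have h := hcas X hX ((LinearMap.mul ℝ ℝ).compl₁₂ ℓ ℓ) (fun Z hZ Z' _ => by
      simp [hℓ, htr k Z hZ])
    have h2 : ∀ i, η ((X * e i - e i * X) q) k = a * η (e i q) k - η (e i q) (X k) := by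
      intro i
      have := h𝔤.skew X hX (e i q) k
      simp only [LinearMap.sub_apply, Module.End.mul_apply, hXq, map_sub, map_smul,
        LinearMap.smul_apply, smul_eq_mul]
      linarith
    simp only [LinearMap.compl₁₂_apply, LinearMap.mul_apply', hℓ, h2] at h
    rw [Finset.mul_sum, ← sub_eq_zero, ← Finset.sum_sub_distrib]
    have h3 : (2 : ℝ) * ∑ i, (a * (η (e i q) k * η (e i q) k) - η (e i q) (X k) * η (e i q) k)
        = 0 := by
      rw [← h, Finset.mul_sum]
      exact Finset.sum_congr rfl fun i _ => by ring
    linarith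
  -- Summed over a frame of `E`, the right side of `h1` vanishes because `X` is skew on `E`. What
  -- remains is `a` times a sum of squares.
  have h2 : ∑ j, ∑ i, η (e i q) (X (f j)) * η (e i q) (f j) = 0 := by
    rw [Finset.sum_comm]
    refine Finset.sum_eq_zero fun i _ => ?_
    let ℓ : E →ₗ[ℝ] ℝ := η (e i q) ∘ₗ E.subtype
    have h := sum_frame_skew_eq_zero (B := η.restrict E) (fun x y => hp.symm x y) hf
      (D := fun k => ⟨X k, h𝔤.orthogonal_invariant hX hXU (hE k)⟩)
      (fun x y => h𝔤.skew X hX x y) ((LinearMap.mul ℝ ℝ).compl₁₂ ℓ ℓ)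
      (fun r hr y => by simp [hrad r hr])
    simp only [LinearMap.compl₁₂_apply, LinearMap.mul_apply', ℓ, LinearMap.comp_apply,
      Submodule.subtype_apply] at h
    have h3 : (2 : ℝ) * ∑ j, η (e i q) (X (f j)) * η (e i q) (f j) = 0 := by
      rw [← h, Finset.mul_sum]
      exact Finset.sum_congr rfl fun i _ => by ring
    linarith
  rw [← Finset.sum_congr rfl fun j _ => h1 (f j), ← Finset.mul_sum] at h2
  have h3 := (mul_eq_zero.1 h2).resolve_left ha
  have h4 : ∀ i j, η (e i q) (f j) = 0 := by
    intro i j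
    rw [Finset.sum_eq_zero_iff_of_nonneg fun j _ =>
      Finset.sum_nonneg fun i _ => mul_self_nonneg _] at h3
    have h5 := h3 j (Finset.mem_univ j)
    rw [Finset.sum_eq_zero_iff_of_nonneg fun i _ => mul_self_nonneg _] at h5
    exact mul_self_eq_zero.1 (h5 i (Finset.mem_univ i))
  have h5 : ∀ i (k : E), η (e i q) k = 0 := by
    intro i k
    have h := hrad _ (hf k)
    rw [sub_eq_zero] at h
    have h' := congrArg (Subtype.val) h
    rw [h', Submodule.coe_sum, map_sum]
    exact Finset.sum_eq_zero fun j _ => by simp [h4]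
  refine hp.mem_of_forall_orthogonal U fun k hk => ?_
  obtain ⟨c, hc⟩ := hspan Y hY
  have h6 := htr ⟨k, hk⟩ _ hc
  rw [hp.symm]
  have h7 : η ((∑ i, c i • e i : End ℝ V) q) k = 0 := by
    rw [LinearMap.sum_apply, map_sum, LinearMap.sum_apply]
    exact Finset.sum_eq_zero fun i _ => by simp [h5 i ⟨k, hk⟩]
  rw [LinearMap.sub_apply, map_sub, LinearMap.sub_apply, h7, sub_zero] at h6
  exact h6

/-- If `𝔤` kills `p` and preserves no proper subspace through `p` transverse to `p^⊥`, then `𝔤` acts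
trivially on `p^⊥` modulo `ℝ p + 𝔱 q`. -/
theorem apply_mem_of_isometric (h𝔤 : IsParabolic η p 𝔤) (hp : IsNullVector η p)
    [FiniteDimensional ℝ V] (hpq : η p q = 1)
    (hirr : ∀ U : Submodule ℝ V, (∀ X ∈ 𝔤, ∀ u ∈ U, X u ∈ U) → p ∈ U →
      (∃ z ∈ U, η p z ≠ 0) → U = ⊤) (h0 : ∀ X ∈ 𝔤, X p = 0) {X : End ℝ V} (hX : X ∈ 𝔤) {w : V}
    (hw : η p w = 0) : X w ∈ translationSpace η p q 𝔤 := by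
  obtain ⟨m, e, heg, hspan, hcas⟩ := h𝔤.exists_casimir hp hpq
  set T := translationSpace η p q 𝔤 with hT
  have hTX : ∀ X ∈ 𝔤, ∀ t ∈ T, X t ∈ T := fun X hX t ht =>
    h𝔤.apply_mem_translationSpace hpq hX ht
  have hk0 : ∀ X ∈ 𝔤, ∀ v ∈ ℝ ∙ p, X v = 0 := by
    intro X hX v hv
    obtain ⟨c, rfl⟩ := Submodule.mem_span_singleton.1 hv
    simp [h0 X hX]
  let P : Submodule ℝ V := η.orthogonal T
  have hP : ∀ k ∈ P, ∀ t ∈ T, η t k = 0 := fun k hk => hk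
  have hPW : ∀ k ∈ P, η p k = 0 := fun k hk => hP k hk p p_mem
  have hPX : ∀ X ∈ 𝔤, ∀ k ∈ P, X k ∈ P := fun X hX k hk =>
    h𝔤.orthogonal_invariant hX (hTX X hX) hk
  -- The Casimir operator is `η`-symmetric, commutes with `𝔤` modulo `T`, and satisfies `η (C k) k =
  -- -∑ η (e i k) (e i k)`, which is nonpositive on `P`.
  let C : End ℝ V := ∑ i, e i * e i
  have hC : ∀ v, C v = ∑ i, e i (e i v) := fun v => by simp [C]
  have hCs : ∀ x y, η (C x) y = η x (C y) := by
    intro x y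
    rw [hC, hC, map_sum, map_sum, LinearMap.sum_apply]
    refine Finset.sum_congr rfl fun i _ => ?_
    have h1 := h𝔤.skew _ (heg i) (e i x) y
    have h2 := h𝔤.skew _ (heg i) x (e i y)
    linarith
  have hCk : ∀ k ∈ P, η (C k) k = 0 → ∀ i, e i k ∈ ℝ ∙ p := by
    intro k hk h i
    have h1 : η (C k) k = -∑ i, η (e i k) (e i k) := by
      rw [hC, map_sum, LinearMap.sum_apply, ← Finset.sum_neg_distrib]
      refine Finset.sum_congr rfl fun i _ => ?_
      have := h𝔤.skew _ (heg i) (e i k) k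
      linarith
    have hW : ∀ i, η p (e i k) = 0 := fun i => h𝔤.apply_orthogonal (heg i) (hPW k hk)
    rw [h, eq_comm, neg_eq_zero, Finset.sum_eq_zero_iff_of_nonneg fun i _ =>
      hp.nonneg _ (hW i)] at h1
    exact hp.mem_span _ (hW i) (h1 i (Finset.mem_univ i))
  let M : Submodule ℝ V := T.comap C
  have hMX : ∀ X ∈ 𝔤, ∀ v ∈ M, X v ∈ M := by
    intro X hX v hv
    refine hp.mem_of_forall_orthogonal T fun k hk => ?_
    let β : End ℝ V →ₗ[ℝ] End ℝ V →ₗ[ℝ] ℝ :=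
      (LinearMap.mul ℝ (End ℝ V)).compr₂ (η k ∘ₗ LinearMap.applyₗ v)
    have hβ : ∀ Y Z, β Y Z = η k (Y (Z v)) := fun _ _ => rfl
    have h := hcas X hX β (fun Y hY Z hZ => by
      rw [hβ, hβ, hp.symm, hp.symm k]
      exact ⟨hk _ (translations_apply_mem hpq hY _),
        hk _ (hTX Z hZ _ (translations_apply_mem hpq hY _))⟩)
    have h2 : η k (X (C v)) = η k (C (X v)) := by
      rw [hC, hC, map_sum, map_sum, map_sum, ← sub_eq_zero, ← Finset.sum_sub_distrib, ← h]
      refine Finset.sum_congr rfl fun i _ => ?_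
      rw [hβ, hβ]
      simp only [LinearMap.sub_apply, Module.End.mul_apply, map_sub]
      ring
    rw [← h2, hp.symm]
    exact hk _ (hTX X hX _ hv)
  have hMp : p ∈ M := by
    change C p ∈ T
    rw [hC, Finset.sum_eq_zero fun i _ => by rw [h0 _ (heg i), map_zero]]
    exact zero_mem _
  have hMz : ∃ z ∈ M, η p z ≠ 0 := by
    by_contra hcon
    push Not at hcon
    -- By symmetry of `C`, the orthogonal complement of `C P` is `M`. If `M ⊆ p^⊥`, then `p = C k`
    -- with `k ∈ P`; so `η (C k) k = 0`, each `e i k` lies in `ℝ p` and is killed by `e i`, and `C k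
    -- = 0`.
    have hmem : p ∈ P.map C := by
      refine hp.mem_of_forall_orthogonal _ fun z hz => ?_
      rw [hp.symm]
      refine hcon z (hp.mem_of_forall_orthogonal T fun k hk => ?_)
      rw [← hCs]
      exact hz _ ⟨k, hk, rfl⟩
    obtain ⟨k, hk, hkp⟩ := hmem
    have h1 := hCk k hk (by rw [hkp, hPW k hk])
    rw [hC, Finset.sum_eq_zero fun i _ => hk0 _ (heg i) _ (h1 i)] at hkp
    rw [← hkp] at hpq
    simp at hpq
  have hMtop := hirr M hMX hMp hMz
  have hCT : ∀ v, C v ∈ T := fun v => by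
    have : v ∈ M := by rw [hMtop]; trivial
    exact this
  -- By duality, `X w ∈ T = P^⊥` follows once `X` maps `P` into `ℝ p`.
  refine hp.mem_of_forall_orthogonal T fun k hk => ?_
  have hXk : X k ∈ ℝ ∙ p := by
    have h1 := hCk k hk (hP k hk _ (hCT k))
    obtain ⟨c, hc⟩ := hspan X hX
    have h2 := hc.2.2 k (hPW k hk)
    rw [LinearMap.sub_apply, LinearMap.sum_apply] at h2
    have h3 : ∑ i, (c i • e i) k ∈ ℝ ∙ p :=
      Submodule.sum_mem _ fun i _ => Submodule.smul_mem _ _ (h1 i)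
    simpa using add_mem h2 h3
  have h1 := h𝔤.skew X hX k w
  rw [eq_zero_of_mem_span hXk hw] at h1
  linarith

/-- If `𝔤` preserves no proper subspace through `p` transverse to `p^⊥`, then the affine space
`{z | η p z = 1}` modulo `ℝ p` is swept out by the flows of two successive elements of `𝔤`. -/
theorem exists_translationSpace (h𝔤 : IsParabolic η p 𝔤) (hp : IsNullVector η p)
    [FiniteDimensional ℝ V] (hpq : η p q = 1)
    (hirr : ∀ U : Submodule ℝ V, (∀ X ∈ 𝔤, ∀ u ∈ U, X u ∈ U) → p ∈ U →
      (∃ z ∈ U, η p z ≠ 0) → U = ⊤) :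
    ∃ o, η p o = 1 ∧ ∀ z z', η p z = 1 → η p z' = 1 → ∃ Y ∈ 𝔤,
      z' - z - Y z ∈ translationSpace η p o 𝔤 ∧ Y (Y z) ∈ translationSpace η p o 𝔤 := by
  by_cases h0 : ∀ X ∈ 𝔤, X p = 0
  · refine ⟨q, hpq, fun z z' hz hz' => ?_⟩
    set T := translationSpace η p q 𝔤 with hT
    have hXT : ∀ X ∈ 𝔤, ∀ w, η p w = 0 → X w ∈ T := fun X hX w hw =>
      h𝔤.apply_mem_of_isometric hp hpq hirr h0 hX hw
    have hXW : ∀ X ∈ 𝔤, ∀ w, η p (X w) = 0 := by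
      intro X hX w
      have := h𝔤.skew X hX p w
      rw [h0 X hX] at this
      simpa using this
    let N : Submodule ℝ V := T ⊔ 𝔤.map (LinearMap.applyₗ q)
    have hNW : ∀ v ∈ N, η p v = 0 := by
      intro v hv
      obtain ⟨t, ht, s, ⟨X, hX, rfl⟩, rfl⟩ := Submodule.mem_sup.1 hv
      rw [map_add, h𝔤.orthogonal_translationSpace hp ht, zero_add]
      exact hXW X hX q
    have htop : N ⊔ ℝ ∙ q = ⊤ := by
      refine hirr _ ?_ (Submodule.mem_sup_left (Submodule.mem_sup_left p_mem))
        ⟨q, Submodule.mem_sup_right (Submodule.mem_span_singleton_self q), by simp [hpq]⟩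
      intro X hX u hu
      obtain ⟨v, hv, s, hs, rfl⟩ := Submodule.mem_sup.1 hu
      obtain ⟨c, rfl⟩ := Submodule.mem_span_singleton.1 hs
      rw [map_add, map_smul]
      refine Submodule.mem_sup_left (add_mem (Submodule.mem_sup_left (hXT X hX v (hNW v hv)))
        (Submodule.smul_mem _ _ (Submodule.mem_sup_right ⟨X, hX, rfl⟩)))
    have hmem : z' - z ∈ N ⊔ ℝ ∙ q := by rw [htop]; trivial
    obtain ⟨v, hv, s, hs, hsum⟩ := Submodule.mem_sup.1 hmem
    obtain ⟨c, rfl⟩ := Submodule.mem_span_singleton.1 hs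
    have hc : c = 0 := by
      have := congrArg (η p) hsum
      simpa [hNW v hv, hpq, hz, hz'] using this
    rw [hc, zero_smul, add_zero] at hsum
    obtain ⟨t, ht, s, ⟨Y, hY, rfl⟩, rfl⟩ := Submodule.mem_sup.1 hv
    refine ⟨Y, hY, ?_, hXT Y hY _ (hXW Y hY z)⟩
    have h1 : z' - z - Y z = t - Y (z - q) := by
      rw [← hsum, map_sub]
      simp only [LinearMap.applyₗ_apply_apply]
      abel
    rw [h1]
    exact sub_mem ht (hXT Y hY _ (by simp [hz, hpq]))
  · push Not at h0
    obtain ⟨X, hX, hXp⟩ := h0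
    obtain ⟨a, ha⟩ := Submodule.mem_span_singleton.1 (h𝔤.line X hX)
    have ha0 : a ≠ 0 := by
      rintro rfl
      exact hXp (by rw [← ha, zero_smul])
    obtain ⟨o, ho, hXo⟩ := h𝔤.exists_opposite hp hpq hX ha0 ha.symm
    -- With `o` as origin, `T` turns out to be all of `p^⊥`, so `Y = 0` suffices.
    refine ⟨o, ho, fun z z' hz hz' => ⟨0, zero_mem _, ?_, zero_mem _⟩⟩
    set T := translationSpace η p o 𝔤 with hT
    have htop : T ⊔ ℝ ∙ o = ⊤ := by
      refine hirr _ ?_ (Submodule.mem_sup_left p_mem)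
        ⟨o, Submodule.mem_sup_right (Submodule.mem_span_singleton_self o), by simp [ho]⟩
      intro Y hY u hu
      obtain ⟨v, hv, s, hs, rfl⟩ := Submodule.mem_sup.1 hu
      obtain ⟨c, rfl⟩ := Submodule.mem_span_singleton.1 hs
      rw [map_add, map_smul]
      exact add_mem (Submodule.mem_sup_left (h𝔤.apply_mem_translationSpace ho hY hv))
        (Submodule.smul_mem _ _ (h𝔤.apply_mem_of_dilation hp ho hX ha0 hXo hY))
    have hmem : z' - z ∈ T ⊔ ℝ ∙ o := by rw [htop]; trivial
    obtain ⟨v, hv, s, hs, hsum⟩ := Submodule.mem_sup.1 hmem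
    obtain ⟨c, rfl⟩ := Submodule.mem_span_singleton.1 hs
    have hc : c = 0 := by
      have := congrArg (η p) hsum
      simpa [h𝔤.orthogonal_translationSpace hp hv, ho, hz, hz'] using this
    rw [hc, zero_smul, add_zero] at hsum
    simpa [← hsum] using hv

end IsParabolic

/-! ### Exponentials and the Lie algebra of `G` -/

section Exponential

variable {V : Type*} [NormedAddCommGroup V] [NormedSpace ℝ V] [FiniteDimensional ℝ V]

theorem exists_linearEquiv_exp (X : V →L[ℝ] V) :
    ∃ g : V ≃ₗ[ℝ] V, ∀ v, g v = NormedSpace.exp X v := by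
  have : CompleteSpace V := FiniteDimensional.complete ℝ V
  let _ : NormedAlgebra ℚ (V →L[ℝ] V) := NormedAlgebra.restrictScalars ℚ ℝ _
  obtain ⟨u, hu⟩ := NormedSpace.isUnit_exp X
  refine ⟨(ContinuousLinearEquiv.unitsEquiv ℝ V u).toLinearEquiv, fun v => ?_⟩
  rw [← hu]
  rfl

/-- The tail of the series stays in `S`, which is closed because the dimension is finite. -/
theorem exp_apply_sub_sum_mem {X : V →L[ℝ] V} {S : Submodule ℝ V} {z : V} {k : ℕ}
    (h : ∀ m, k ≤ m → (X ^ m) z ∈ S) :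
    NormedSpace.exp X z - ∑ m ∈ Finset.range k, (m.factorial : ℝ)⁻¹ • (X ^ m) z ∈ S := by
  have : CompleteSpace V := FiniteDimensional.complete ℝ V
  have h1 := (NormedSpace.exp_series_hasSum_exp' (𝕂 := ℝ) X).mapL
    (ContinuousLinearMap.apply ℝ V z)
  have h2 : HasSum (fun m : ℕ => (m.factorial : ℝ)⁻¹ • (X ^ m) z) (NormedSpace.exp X z) := by
    simpa using h1
  have h3 := (hasSum_nat_add_iff' k).2 h2
  refine S.closed_of_finiteDimensional.mem_of_tendsto h3 (Filter.Eventually.of_forall fun s => ?_)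
  exact Submodule.sum_mem _ fun i _ => Submodule.smul_mem _ _ (h _ (by omega))

theorem exp_apply_mem {X : V →L[ℝ] V} {S : Submodule ℝ V} (hS : ∀ v ∈ S, X v ∈ S) {z : V}
    (hz : z ∈ S) : NormedSpace.exp X z ∈ S := by
  have h : ∀ m : ℕ, (X ^ m) z ∈ S := by
    intro m
    induction m with
    | zero => simpa using hz
    | succ m ih => rw [pow_succ']; exact hS _ ih
  simpa using exp_apply_sub_sum_mem (k := 0) fun m _ => h m

theorem exp_apply_sub_mem {X : V →L[ℝ] V} {S : Submodule ℝ V} (hS : ∀ v ∈ S, X v ∈ S) {z : V}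
    (hz : X (X z) ∈ S) : NormedSpace.exp X z - z - X z ∈ S := by
  have h : ∀ m : ℕ, (X ^ (m + 2)) z ∈ S := by
    intro m
    induction m with
    | zero => simpa [pow_two] using hz
    | succ m ih => rw [pow_succ']; exact hS _ ih
  have := exp_apply_sub_sum_mem (X := X) (S := S) (z := z) (k := 2) fun m hm => by
    obtain ⟨j, rfl⟩ := Nat.exists_eq_add_of_le' hm
    exact h j
  simpa [Finset.sum_range_succ, sub_sub] using this

theorem hasDerivAt_exp_smul_apply (X : V →L[ℝ] V) (v : V) :
    HasDerivAt (fun t : ℝ => NormedSpace.exp (t • X) v) (X v) 0 := by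
  have : CompleteSpace V := FiniteDimensional.complete ℝ V
  have h := (hasDerivAt_exp_smul_const (𝕂 := ℝ) X 0).clm_apply (hasDerivAt_const (0 : ℝ) v)
  simpa using h

variable {η : LinearMap.BilinForm ℝ V} {p : V} {𝔤 : Submodule ℝ (V →L[ℝ] V)}

/-- The Lie algebra of a connected Lie subgroup of `SO(V)_{ℝ p}`. -/
theorem isParabolic_of_le (hlie : ∀ X ∈ 𝔤, ∀ Y ∈ 𝔤, X * Y - Y * X ∈ 𝔤)
    (hle : Subgroup.closure {g : V ≃ₗ[ℝ] V | ∃ X ∈ 𝔤, ∀ v, g v = NormedSpace.exp X v} ≤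
      SOLine η p) :
    IsParabolic η p (𝔤.map (ContinuousLinearMap.coeLM ℝ)) := by
  have hexp : ∀ X ∈ 𝔤, ∀ t : ℝ, (∀ x y, η (NormedSpace.exp (t • X) x)
      (NormedSpace.exp (t • X) y) = η x y) ∧ NormedSpace.exp (t • X) p ∈ ℝ ∙ p := by
    intro X hX t
    obtain ⟨g, hg⟩ := exists_linearEquiv_exp (t • X)
    have hgG := hle (Subgroup.subset_closure ⟨t • X, 𝔤.smul_mem t hX, hg⟩)
    simp only [← hg]
    refine ⟨hgG.1.1, ?_⟩
    rw [← hgG.2]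
    exact Submodule.mem_map_of_mem (Submodule.mem_span_singleton_self p)
  refine ⟨?_, ?_, ?_⟩
  · rintro _ ⟨X, hX, rfl⟩ _ ⟨Y, hY, rfl⟩
    exact ⟨_, hlie X hX Y hY, rfl⟩
  · rintro _ ⟨X, hX, rfl⟩ x y
    let b := η.toContinuousBilinearMap
    have hb : ∀ x y, b x y = η x y := fun _ _ => rfl
    have h1 := (b.hasFDerivAt.comp_hasDerivAt (0 : ℝ) (hasDerivAt_exp_smul_apply X x)).clm_apply
      (hasDerivAt_exp_smul_apply X y)
    simp only [Function.comp_apply] at h1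
    -- Skewness is the derivative at `0` of this constant function.
    have h2 : (fun t : ℝ => b (NormedSpace.exp (t • X) x) (NormedSpace.exp (t • X) y)) =
        fun _ => η x y := funext fun t => (hexp X hX t).1 x y
    rw [h2] at h1
    have h3 := h1.unique (hasDerivAt_const (0 : ℝ) (η x y))
    simp only [zero_smul, NormedSpace.exp_zero, hb] at h3
    exact h3
  · rintro _ ⟨X, hX, rfl⟩
    have h1 := (hasDerivAt_iff_tendsto_slope.1 (hasDerivAt_exp_smul_apply X p))
    refine (ℝ ∙ p).closed_of_finiteDimensional.mem_of_tendsto h1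
      (Filter.Eventually.of_forall fun t => ?_)
    rw [slope_def_module]
    exact Submodule.smul_mem _ _ (sub_mem (hexp X hX t).2 (hexp X hX 0).2)

/-- A subspace invariant under the Lie algebra is invariant under the group. -/
theorem closure_exp_invariant {U : Submodule ℝ V} (hU : ∀ X ∈ 𝔤, ∀ u ∈ U, X u ∈ U)
    {g : V ≃ₗ[ℝ] V}
    (hg : g ∈ Subgroup.closure {g : V ≃ₗ[ℝ] V | ∃ X ∈ 𝔤, ∀ v, g v = NormedSpace.exp X v}) :
    ∀ u ∈ U, g u ∈ U := by
  have hmap : ∀ {g : V ≃ₗ[ℝ] V}, (∀ u ∈ U, g u ∈ U) → ∀ u ∈ U, g⁻¹ u ∈ U := by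
    intro g hg u hu
    have h1 : U.map (g : V →ₗ[ℝ] V) ≤ U := by
      rintro _ ⟨u, hu, rfl⟩
      exact hg u hu
    have h2 := Submodule.eq_of_le_of_finrank_eq h1 (LinearEquiv.finrank_map_eq g U)
    rw [← h2] at hu
    obtain ⟨u', hu', rfl⟩ := hu
    exact (g.symm_apply_apply u').symm ▸ hu'
  induction hg using Subgroup.closure_induction with
  | mem g hg =>
    obtain ⟨X, hX, hgX⟩ := hg
    intro u hu
    rw [hgX]
    exact exp_apply_mem (hU X hX) hu
  | one => exact fun u hu => hu
  | mul g h _ _ hg hh => exact fun u hu => hg _ (hh u hu)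
  | inv g _ hg => exact hmap hg

end Exponential

/-! ### Lorentzian signature and transitivity on normalized null vectors -/

variable {η : LinearMap.BilinForm ℝ V}

/-- A null vector of a form of signature `(1, n + 1)`. -/
theorem IsMinkowski.isNullVector {n : ℕ} (hη : IsMinkowski η n) {p : V} (hp0 : p ≠ 0)
    (hp : η p p = 0) : IsNullVector η p := by
  obtain ⟨e, he⟩ := hη
  have hexp : ∀ x y, η x y = ∑ i, (if i = 0 then -1 else 1) * (e.repr x i * e.repr y i) := by
    intro x y
    conv_lhs => rw [← e.sum_repr x, ← e.sum_repr y]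
    rw [map_sum η, LinearMap.sum_apply]
    refine Finset.sum_congr rfl fun i _ => ?_
    rw [map_sum, Finset.sum_eq_single i]
    · simp [he]
      ring
    · intro j _ hj
      simp [he, hj.symm]
    · simp
  have hpos : ∀ x, e.repr x 0 = 0 → 0 ≤ η x x ∧ (η x x = 0 → x = 0) := by
    intro x hx
    have hterm : ∀ i, (if i = 0 then -1 else 1) * (e.repr x i * e.repr x i) =
        e.repr x i * e.repr x i := by
      intro i
      by_cases hi : i = 0
      · simp [hi, hx]
      · simp [hi]
    rw [hexp, Finset.sum_congr rfl fun i _ => hterm i]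
    refine ⟨Finset.sum_nonneg fun i _ => mul_self_nonneg _, fun h => ?_⟩
    rw [Finset.sum_eq_zero_iff_of_nonneg fun i _ => mul_self_nonneg _] at h
    refine e.repr.map_eq_zero_iff.1 (Finsupp.ext fun i => ?_)
    exact mul_self_eq_zero.1 (h i (Finset.mem_univ i))
  have hsymm : ∀ x y, η x y = η y x := by
    intro x y
    rw [hexp, hexp]
    exact Finset.sum_congr rfl fun i _ => by ring
  have hpc : e.repr p 0 ≠ 0 := fun h => hp0 ((hpos p h).2 hp)
  -- Subtracting a multiple of `p` removes the timelike coordinate without changing the square of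
  -- `w`.
  have hsub : ∀ w, η p w = 0 → ∃ c : ℝ, e.repr (w - c • p) 0 = 0 ∧
      η (w - c • p) (w - c • p) = η w w := by
    intro w hw
    refine ⟨e.repr w 0 / e.repr p 0, by simp [hpc], ?_⟩
    simp [hp, hw, hsymm w p]
  refine ⟨hsymm, fun x hx => ?_, hp, fun w hw => ?_, fun w hw hww => ?_⟩
  · refine e.repr.map_eq_zero_iff.1 (Finsupp.ext fun i => ?_)
    have := hx (e i)
    rw [hexp, Finset.sum_eq_single i] at this
    · by_cases hi : i = 0
      · subst hi
        simpa using this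
      · simpa [hi] using this
    · intro j _ hj
      simp [hj.symm]
    · simp
  · obtain ⟨c, h1, h2⟩ := hsub w hw
    rw [← h2]
    exact (hpos _ h1).1
  · obtain ⟨c, h1, h2⟩ := hsub w hw
    have := (hpos _ h1).2 (h2.trans hww)
    rw [sub_eq_zero] at this
    exact Submodule.mem_span_singleton.2 ⟨c, this.symm⟩

namespace IsNullVector

variable {p : V}

/-- A null vector is determined by its class modulo `ℝ p` and its product with `p`. -/
theorem eq_of_sub_mem (hp : IsNullVector η p) {z z' : V} (hz : η p z = 1) (hzz : η z z = 0)
    (hzz' : η z' z' = 0) (h : z' - z ∈ ℝ ∙ p) : z' = z := by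
  obtain ⟨c, hc⟩ := Submodule.mem_span_singleton.1 h
  have h1 : z' = z + c • p := by rw [hc]; abel
  rw [h1] at hzz'
  simp only [map_add, map_smul, LinearMap.add_apply, LinearMap.smul_apply, smul_eq_mul, hzz, hz,
    hp.symm z p, hp.null] at hzz'
  have : c = 0 := by linarith
  rw [h1, this, zero_smul, add_zero]

/-- A subspace through `p` that is transverse to `p^⊥` is nondegenerate. -/
theorem restrict_nondegenerate (hp : IsNullVector η p)
    {U : Submodule ℝ V} (hpU : p ∈ U) {z : V} (hzU : z ∈ U)
    (hz : η p z ≠ 0) : (η.restrict U).Nondegenerate := by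
  have h : ∀ x : U, (∀ y : U, η x y = 0) → x = 0 := by
    intro x hx
    have h1 := hx ⟨p, hpU⟩
    rw [hp.symm] at h1
    obtain ⟨c, hc⟩ := Submodule.mem_span_singleton.1 (hp.mem_span x h1 (hx x))
    have h2 := hx ⟨z, hzU⟩
    rw [← hc, map_smul, LinearMap.smul_apply, smul_eq_mul] at h2
    rw [(mul_eq_zero.1 h2).resolve_right hz, zero_smul] at hc
    exact Subtype.ext hc.symm
  exact ⟨fun x hx => h x hx, fun x hx => h x fun y => by rw [hp.symm]; exact hx y⟩

end IsNullVector

/-- A weakly irreducible connected Lie subgroup of `SO(V)_{ℝ p}` is transitive on the null vectors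
normalized against `p`. -/
theorem IsWeaklyIrreducible.exists_apply_eq {V : Type*} [NormedAddCommGroup V] [NormedSpace ℝ V]
    [FiniteDimensional ℝ V] {η : LinearMap.BilinForm ℝ V} {p q : V} (hp : IsNullVector η p)
    (hpq : η p q = 1) {G : Subgroup (V ≃ₗ[ℝ] V)} (hG : G ≤ SOLine η p)
    (hconn : IsConnectedLieSubgroup G) (hirr : IsWeaklyIrreducible η G) {z z' : V}
    (hz : η p z = 1) (hzz : η z z = 0) (hz' : η p z' = 1) (hzz' : η z' z' = 0) :
    ∃ g ∈ G, g z = z' := by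
  obtain ⟨𝔤, hlie, rfl⟩ := hconn
  have h𝔤 := isParabolic_of_le hlie hG
  set 𝔤' := 𝔤.map (ContinuousLinearMap.coeLM ℝ) with h𝔤'
  obtain ⟨o, ho, hsweep⟩ := h𝔤.exists_translationSpace hp hpq fun U hU hpU ⟨u, huU, hu⟩ => by
    refine (hirr U (fun g hg => closure_exp_invariant (fun X hX => hU X ⟨X, hX, rfl⟩) hg)
      (hp.restrict_nondegenerate hpU huU hu)).resolve_left ?_
    rintro rfl
    rw [Submodule.mem_bot] at huU
    exact hu (by rw [huU, map_zero])
  obtain ⟨_, ⟨Y, hY, rfl⟩, hY1, hY2⟩ := hsweep z z' hz hz'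
  set T := translationSpace η p o 𝔤' with hT
  obtain ⟨g, hg⟩ := exists_linearEquiv_exp Y
  -- `exp Y` reaches `z'` modulo `T`. A translation then removes the error modulo `ℝ p`, and nullity
  -- removes the rest.
  have hgz : z' - g z ∈ T := by
    have h1 : NormedSpace.exp Y z - z - Y z ∈ T :=
      exp_apply_sub_mem (fun v hv => h𝔤.apply_mem_translationSpace ho ⟨Y, hY, rfl⟩ hv) hY2
    have h2 := sub_mem hY1 h1
    rw [hg]
    convert h2 using 1
    simp
  have hpg : η p (g z) = 1 := by
    have := h𝔤.orthogonal_translationSpace hp hgz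
    rw [map_sub, hz'] at this
    linarith
  obtain ⟨c, _, ⟨⟨X, hX, rfl⟩, hXp, hXW⟩, hcX⟩ := IsParabolic.mem_iff.1 hgz
  obtain ⟨h, hh⟩ := exists_linearEquiv_exp X
  have hmem : h * g ∈ Subgroup.closure
      {g : V ≃ₗ[ℝ] V | ∃ X ∈ 𝔤, ∀ v, g v = NormedSpace.exp X v} :=
    mul_mem (Subgroup.subset_closure ⟨X, hX, hh⟩) (Subgroup.subset_closure ⟨Y, hY, hg⟩)
  refine ⟨h * g, hmem, ?_⟩
  have hXp' : X p = 0 := hXp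
  have hXW' : ∀ w, η p w = 0 → X w ∈ ℝ ∙ p := hXW
  have hXz : η p (X (g z)) = 0 := by
    have := h𝔤.skew _ ⟨X, hX, rfl⟩ p (g z)
    rw [hXp] at this
    simpa using this
  have h1 : NormedSpace.exp X (g z) - g z - X (g z) ∈ ℝ ∙ p := by
    refine exp_apply_sub_mem (fun v hv => hXW' v ?_) (hXW' _ hXz)
    rw [hp.symm]
    exact eq_zero_of_mem_span hv hp.null
  have h2 : X (g z - o) ∈ ℝ ∙ p := hXW' _ (by simp [hpg, ho])
  have h3 : z' - g z = c • p + X o := hcX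
  have hSO := (hG hmem).1.1
  have h4 : (h * g) z - z' ∈ ℝ ∙ p := by
    have h5 := sub_mem (add_mem h1 h2) (Submodule.smul_mem _ c
      (Submodule.mem_span_singleton_self p))
    convert h5 using 1
    rw [LinearEquiv.mul_apply, hh, ← sub_add_sub_cancel _ (g z) z', ← neg_sub z', h3, map_sub]
    abel
  exact hp.eq_of_sub_mem hz' hzz' ((hSO z z).trans hzz) h4

/-! ### Null lines; from transitivity to weak irreducibility -/

variable {p q : V}

theorem image_span_singleton (g : V ≃ₗ[ℝ] V) (v : V) : image g (ℝ ∙ v) = ℝ ∙ g v :=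
  (Submodule.map_span _ _).trans (by simp)

theorem span_singleton_mem_boundary {z : V} (hz0 : z ≠ 0) (hzz : η z z = 0) :
    (ℝ ∙ z) ∈ boundary η := by
  refine ⟨finrank_span_singleton hz0, fun x hx => ?_⟩
  obtain ⟨c, rfl⟩ := Submodule.mem_span_singleton.1 hx
  simp [hzz]

/-- The null line obtained from `v` by a shift along `p`. -/
theorem null_shift (hp : IsNullVector η p) {v : V} (hv : η p v ≠ 0) :
    η (v - (η v v / (2 * η p v)) • p) (v - (η v v / (2 * η p v)) • p) = 0 := by
  simp only [map_sub, map_smul, LinearMap.sub_apply, LinearMap.smul_apply, smul_eq_mul, hp.null,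
    hp.symm v p]
  field_simp
  ring_nf

theorem span_singleton_mem_boundary_diff (hp : IsNullVector η p) {z : V} (hz : η p z ≠ 0)
    (hzz : η z z = 0) : (ℝ ∙ z) ∈ boundary η \ {ℝ ∙ p} := by
  refine ⟨span_singleton_mem_boundary (fun h => hz (by rw [h, map_zero])) hzz, fun h => hz ?_⟩
  have hmem : z ∈ ℝ ∙ p := h ▸ Submodule.mem_span_singleton_self z
  rw [hp.symm]
  exact eq_zero_of_mem_span hmem hp.null

/-- Every null line other than `ℝ p` is spanned by a null vector normalized against `p`. -/
theorem exists_normalized (hp : IsNullVector η p) {l : Submodule ℝ V}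
    (hl : l ∈ boundary η \ {ℝ ∙ p}) : ∃ z, η p z = 1 ∧ η z z = 0 ∧ l = ℝ ∙ z := by
  obtain ⟨⟨hfin, hnull⟩, hne⟩ := hl
  obtain ⟨⟨v, hvl⟩, hv0, hv⟩ := finrank_eq_one_iff'.1 hfin
  have hv0' : v ≠ 0 := fun h => hv0 (Subtype.ext h)
  have hlv : l = ℝ ∙ v := by
    refine le_antisymm (fun x hx => ?_) ((Submodule.span_singleton_le_iff_mem _ _).2 hvl)
    obtain ⟨c, hc⟩ := hv ⟨x, hx⟩
    exact Submodule.mem_span_singleton.2 ⟨c, congrArg Subtype.val hc⟩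
  have hpv : η p v ≠ 0 := by
    intro h
    obtain ⟨c, hc⟩ := Submodule.mem_span_singleton.1 (hp.mem_span v h (hnull v hvl))
    have hc0 : c ≠ 0 := by
      rintro rfl
      exact hv0' (by rw [← hc, zero_smul])
    refine hne ?_
    rw [Set.mem_singleton_iff, hlv, ← hc]
    exact Submodule.span_singleton_smul_eq (IsUnit.mk0 c hc0) p
  refine ⟨(η p v)⁻¹ • v, by simp [hpv], by simp [hnull v hvl], ?_⟩
  rw [hlv]
  exact (Submodule.span_singleton_smul_eq (IsUnit.mk0 _ (inv_ne_zero hpv)) v).symm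

/-- A group transitive on the null lines other than `ℝ p` preserves no proper subspace through `p`
transverse to `p^⊥`. -/
theorem IsTransitiveOnBoundary.eq_top (hp : IsNullVector η p) {G : Subgroup (V ≃ₗ[ℝ] V)}
    (hG : IsTransitiveOnBoundary η p G) {U : Submodule ℝ V} (hU : ∀ g ∈ G, ∀ u ∈ U, g u ∈ U)
    (hpU : p ∈ U) {z : V} (hzU : z ∈ U) (hz : η p z ≠ 0) : U = ⊤ := by
  have hshift : ∀ v : V, ∀ c : ℝ, η p (v - c • p) = η p v := by
    intro v c
    simp [hp.null]
  have h1 : ∀ v, η p v ≠ 0 → v ∈ U := by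
    intro v hv
    obtain ⟨g, hg, hgl⟩ := hG _ (span_singleton_mem_boundary_diff hp
      (by rwa [hshift]) (null_shift hp hz)) _ (span_singleton_mem_boundary_diff hp
      (by rwa [hshift]) (null_shift hp hv))
    rw [image_span_singleton] at hgl
    have hmem := Submodule.mem_span_singleton_self (R := ℝ) (v - (η v v / (2 * η p v)) • p)
    rw [← hgl] at hmem
    have hle := (Submodule.span_singleton_le_iff_mem _ _).2
      (hU g hg _ (sub_mem hzU (U.smul_mem (η z z / (2 * η p z)) hpU)))
    have h2 := add_mem (hle hmem) (U.smul_mem (η v v / (2 * η p v)) hpU)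
    simpa using h2
  refine (Submodule.eq_top_iff').2 fun v => ?_
  by_cases hv : η p v = 0
  · have := sub_mem (h1 (v + z) (by simpa [hv] using hz)) hzU
    simpa using this
  · exact h1 v hv

/-- Transitivity on the null lines other than `ℝ p` implies weak irreducibility. -/
theorem IsTransitiveOnBoundary.isWeaklyIrreducible [FiniteDimensional ℝ V]
    (hp : IsNullVector η p) (hpq : η p q = 1)
    (hdim : 3 ≤ finrank ℝ V) {G : Subgroup (V ≃ₗ[ℝ] V)} (hGle : G ≤ SOLine η p)
    (hG : IsTransitiveOnBoundary η p G) : IsWeaklyIrreducible η G := by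
  intro U hU hnd
  have hcompl := LinearMap.BilinForm.isCompl_orthogonal_of_restrict_nondegenerate hp.isRefl hnd
  set U' := η.orthogonal U with hU'
  have hU'inv : ∀ g ∈ G, ∀ u ∈ U', g u ∈ U' := by
    intro g hg u hu k hk
    have h1 := (hGle (inv_mem hg)).1.1 k (g u)
    change η k (g u) = 0
    rw [← h1]
    have h2 : g⁻¹ (g u) = u := g.symm_apply_apply u
    rw [h2]
    exact hu _ (hU _ (inv_mem hg) k hk)
  have hort : ∀ u ∈ U, ∀ u' ∈ U', η u u' = 0 := fun u hu u' hu' => hu' u hu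
  have hort' : ∀ u ∈ U, ∀ u' ∈ U', η u' u = 0 := fun u hu u' hu' => by
    rw [hp.symm]; exact hort u hu u' hu'
  have hsplit : ∀ v : V, ∃ u ∈ U, ∃ u' ∈ U', u + u' = v := fun v =>
    Submodule.mem_sup.1 (by rw [hcompl.sup_eq_top]; trivial)
  obtain ⟨u, hu, u', hu', hp'⟩ := hsplit p
  obtain ⟨v, hv, v', hv', hq'⟩ := hsplit q
  have hpq' : η p v + η p v' = 1 := by rw [← map_add, hq', hpq]
  by_cases h0 : u = 0
  · rw [h0, zero_add] at hp'
    rw [hp'] at hu'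
    have htop := hG.eq_top hp hU'inv hu' hv' (z := v') (by
      rw [hort' v hv p hu'] at hpq'
      rw [zero_add] at hpq'
      simp [hpq'])
    left
    have := hcompl.inf_eq_bot
    rwa [htop, inf_top_eq] at this
  by_cases h0' : u' = 0
  · rw [h0', add_zero] at hp'
    rw [hp'] at hu
    right
    exact hG.eq_top hp hU hu hv (by
      rw [hort p hu v' hv'] at hpq'
      rw [add_zero] at hpq'
      simp [hpq'])
  -- Both components of `p` are nonzero, so `u - u'` spans a second null line. Each `g ∈ G` scales
  -- `u` and `u'` by the same factor as `p`, hence fixes that line.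
  exfalso
  have hdisj : ∀ x ∈ U, x ∈ U' → x = 0 := fun x hx hx' =>
    (Submodule.disjoint_def.1 hcompl.disjoint) x hx hx'
  have huu : η u u + η u' u' = 0 := by
    have := hp.null
    rw [← hp'] at this
    simp only [map_add, LinearMap.add_apply, hort u hu u' hu', hort' u hu u' hu'] at this
    linarith
  have hss : η (u - u') (u - u') = 0 := by
    simp only [map_sub, LinearMap.sub_apply, hort u hu u' hu', hort' u hu u' hu']
    linarith
  have hps : η p (u - u') ≠ 0 := by
    intro h
    obtain ⟨c, hc⟩ := Submodule.mem_span_singleton.1 (hp.mem_span _ h hss)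
    rw [← hp', smul_add] at hc
    have h1 : (c - 1) • u = -((c + 1) • u') := by
      rw [sub_smul, add_smul, one_smul, one_smul, sub_eq_iff_eq_add, eq_comm]
      rw [← sub_eq_zero] at hc ⊢
      rw [← neg_eq_zero, ← hc]
      abel
    have h2 : (c - 1) • u = 0 := hdisj _ (U.smul_mem _ hu)
      (h1 ▸ U'.neg_mem (U'.smul_mem _ hu'))
    have h3 := (smul_eq_zero.1 h2).resolve_right h0
    rw [h2, eq_comm, neg_eq_zero] at h1
    have h4 := (smul_eq_zero.1 h1).resolve_right h0'
    linarith
  have hfix : ∀ g ∈ G, image g (ℝ ∙ (u - u')) ≤ ℝ ∙ (u - u') := by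
    intro g hg
    have hgp : g p ∈ ℝ ∙ p := by
      rw [← (hGle hg).2]
      exact Submodule.mem_map_of_mem (Submodule.mem_span_singleton_self p)
    obtain ⟨c, hc⟩ := Submodule.mem_span_singleton.1 hgp
    rw [← hp', map_add, smul_add] at hc
    have h1 : c • u - g u = g u' - c • u' := by
      rw [sub_eq_sub_iff_add_eq_add, hc, add_comm]
    have h2 : c • u - g u = 0 := hdisj _ (U.sub_mem (U.smul_mem _ hu) (hU g hg u hu))
      (h1 ▸ U'.sub_mem (hU'inv g hg u' hu') (U'.smul_mem _ hu'))
    rw [h2, eq_comm, sub_eq_zero] at h1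
    rw [sub_eq_zero] at h2
    rw [image_span_singleton, Submodule.span_singleton_le_iff_mem, map_sub, ← h2, h1, ← smul_sub]
    exact Submodule.smul_mem _ _ (Submodule.mem_span_singleton_self _)
  have hall : ∀ z, η p z ≠ 0 → η z z = 0 → z ∈ ℝ ∙ (u - u') := by
    intro z hz hzz
    obtain ⟨g, hg, hgl⟩ := hG _ (span_singleton_mem_boundary_diff hp hps hss) _
      (span_singleton_mem_boundary_diff hp hz hzz)
    exact hfix g hg (hgl ▸ Submodule.mem_span_singleton_self z)
  -- Every vector off `p^⊥` is null up to a multiple of `p`, and such vectors span `V`; so `V` would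
  -- be a plane.
  have hle : (⊤ : Submodule ℝ V) ≤ (ℝ ∙ p) ⊔ ℝ ∙ (u - u') := by
    have h1 : ∀ y, η p y ≠ 0 → y ∈ (ℝ ∙ p) ⊔ ℝ ∙ (u - u') := by
      intro y hy
      have h2 := hall _ (by simpa [hp.null] using hy) (null_shift hp hy)
      have h3 := add_mem (Submodule.mem_sup_left (T := ℝ ∙ (u - u')) (Submodule.smul_mem (ℝ ∙ p)
        (η y y / (2 * η p y)) (Submodule.mem_span_singleton_self p)))
        (Submodule.mem_sup_right (S := ℝ ∙ p) h2)
      simpa using h3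
    intro y _
    by_cases hy : η p y = 0
    · have := sub_mem (h1 (y + q) (by simp [hy, hpq])) (h1 q (by simp [hpq]))
      simpa using this
    · exact h1 y hy
  have hfr := Submodule.finrank_mono hle
  have hfr2 := Submodule.finrank_add_le_finrank_add_finrank (ℝ ∙ p) (ℝ ∙ (u - u'))
  have h3 := finrank_span_le_card (R := ℝ) ({p} : Set V)
  have h4 := finrank_span_le_card (R := ℝ) ({u - u'} : Set V)
  rw [finrank_top] at hfr
  simp only [Set.toFinset_singleton, Finset.card_singleton] at h3 h4
  omega

/-! ### Stereographic coordinates -/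

/-- The null line of a point of `E` under inverse stereographic projection. -/
theorem span_stereoInv (hp : IsNullVector η p) {Y : V} (hY : Y ∈ euclid η p q) :
    (ℝ ∙ stereoInv η p q Y) = ℝ ∙ (q - √2 • Y - η Y Y • p) := by
  have hN : 0 ≤ η Y Y := hp.nonneg Y hY.1
  have h1 : (1 + η Y Y) ≠ 0 := by positivity
  have h2 : √2 * √2 = 2 := Real.mul_self_sqrt (by norm_num)
  have h3 : √2 ≠ 0 := by positivity
  -- The factor is the coefficient of `q` in `stereoInv η p q Y`.
  have h4 : stereoInv η p q Y = (-√2 / (1 + η Y Y)) • (q - √2 • Y - η Y Y • p) := by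
    rw [stereoInv]
    match_scalars
    · field_simp
      ring_nf
    · field_simp
    · field_simp
      linarith
  rw [h4]
  exact Submodule.span_singleton_smul_eq
    (IsUnit.mk0 _ (div_ne_zero (neg_ne_zero.2 h3) h1)) _

theorem normalized_stereo (hp : IsNullVector η p) (hpq : η p q = 1) (hq : η q q = 0) {Y : V}
    (hY : Y ∈ euclid η p q) : η p (q - √2 • Y - η Y Y • p) = 1 ∧
      η (q - √2 • Y - η Y Y • p) (q - √2 • Y - η Y Y • p) = 0 := by
  have h1 : η p Y = 0 := hY.1
  have h2 : η q Y = 0 := hY.2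
  have h3 : √2 * √2 = 2 := Real.mul_self_sqrt (by norm_num)
  constructor
  · simp [h1, hpq, hp.null]
  · simp only [map_sub, map_smul, LinearMap.sub_apply, LinearMap.smul_apply, smul_eq_mul, hp.null,
      hp.symm q p, hp.symm Y p, hp.symm Y q, h1, h2, hpq, hq]
    linear_combination (η Y Y) * h3

/-- Stereographic projection is onto: every null line other than `ℝ p` is the line of a point
of `E`. -/
theorem exists_span_stereoInv (hp : IsNullVector η p) (hpq : η p q = 1)
    (hq : η q q = 0) {l : Submodule ℝ V} (hl : l ∈ boundary η \ {ℝ ∙ p}) :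
    ∃ Y ∈ euclid η p q, l = ℝ ∙ stereoInv η p q Y := by
  obtain ⟨z, hz, hzz, rfl⟩ := exists_normalized hp hl
  have h3 : √2 ≠ 0 := by positivity
  -- Solves `q - √2 Y ≡ z` modulo `ℝ p`; the multiple of `p` makes `Y` orthogonal to `q`.
  let Y : V := (-(√2)⁻¹) • (z - q - η q z • p)
  have hY : Y ∈ euclid η p q := by
    refine ⟨?_, ?_⟩
    · simp [Y, hz, hpq, hp.null]
    · simp [Y, hq, hp.symm q p, hpq]
  have hYz : q - √2 • Y = z - η q z • p := by
    simp only [Y, smul_smul, mul_neg, mul_inv_cancel₀ h3]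
    module
  refine ⟨Y, hY, ?_⟩
  obtain ⟨h1, h2⟩ := normalized_stereo hp hpq hq hY
  rw [span_stereoInv hp hY, hp.eq_of_sub_mem hz hzz h2 ?_]
  rw [hYz]
  refine Submodule.mem_span_singleton.2 ⟨-η q z - η Y Y, ?_⟩
  module

theorem isTransitiveOnBoundary_iff_euclid (hp : IsNullVector η p) (hpq : η p q = 1)
    (hq : η q q = 0) (G : Subgroup (V ≃ₗ[ℝ] V)) :
    IsTransitiveOnBoundary η p G ↔ IsTransitiveOnEuclid η p q G := by
  have hmem : ∀ Y ∈ euclid η p q, (ℝ ∙ stereoInv η p q Y) ∈ boundary η \ {ℝ ∙ p} := by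
    intro Y hY
    obtain ⟨h1, h2⟩ := normalized_stereo hp hpq hq hY
    rw [span_stereoInv hp hY]
    exact span_singleton_mem_boundary_diff hp (by simp [h1]) h2
  constructor
  · exact fun h X hX Y hY => h _ (hmem X hX) _ (hmem Y hY)
  · intro h l hl l' hl'
    obtain ⟨X, hX, rfl⟩ := exists_span_stereoInv hp hpq hq hl
    obtain ⟨Y, hY, rfl⟩ := exists_span_stereoInv hp hpq hq hl'
    exact h X hX Y hY

end Minkowski

theorem theorem4 {V : Type*} [NormedAddCommGroup V] [NormedSpace ℝ V]
    (n : ℕ) (hn : 1 ≤ n)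
    (η : LinearMap.BilinForm ℝ V) (hη : Minkowski.IsMinkowski η n)
    (p q : V) (hp : η p p = 0) (hq : η q q = 0) (hpq : η p q = 1)
    (G : Subgroup (V ≃ₗ[ℝ] V)) (hG : G < Minkowski.SOLine η p)
    (hconn : Minkowski.IsConnectedLieSubgroup G) :
    (Minkowski.IsWeaklyIrreducible η G ↔ Minkowski.IsTransitiveOnBoundary η p G) ∧
    (Minkowski.IsWeaklyIrreducible η G ↔ Minkowski.IsTransitiveOnEuclid η p q G) := by
  have hp0 : p ≠ 0 := by
    rintro rfl
    simp at hpq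
  have hnull := hη.isNullVector hp0 hp
  obtain ⟨e, -⟩ := hη
  have : FiniteDimensional ℝ V := e.finiteDimensional_of_finite
  have hdim : 3 ≤ finrank ℝ V := by
    rw [finrank_eq_card_basis e, Fintype.card_fin]
    omega
  have h12 : Minkowski.IsWeaklyIrreducible η G ↔ Minkowski.IsTransitiveOnBoundary η p G := by
    refine ⟨fun h l hl l' hl' => ?_, fun h => h.isWeaklyIrreducible hnull hpq hdim hG.le⟩
    obtain ⟨z, hz, hzz, rfl⟩ := Minkowski.exists_normalized hnull hl
    obtain ⟨z', hz', hzz', rfl⟩ := Minkowski.exists_normalized hnull hl'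
    obtain ⟨g, hg, hgz⟩ := h.exists_apply_eq hnull hpq hG.le hconn hz hzz hz' hzz'
    exact ⟨g, hg, by rw [Minkowski.image_span_singleton, hgz]⟩
  exact ⟨h12, h12.trans (Minkowski.isTransitiveOnBoundary_iff_euclid hnull hpq hq G)⟩
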